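/- For real numbers $\lambda,b$ with $0<1-\lambda<b<1$, put $c=\frac{1-b}{\lambda}$ and let the contracted rotation $R_{\lambda,b}:[0,1)\to[0,1)$ be the map $$R_{\lambda,b}(x)=\begin{cases}\lambda x+b, & 0\le x<c,\\ \lambda x+b-1, & c\le x<1.\end{cases}$$ Its rotation number is $\rho(R_{\lambda,b})=\lim_{n\to\infty}\frac{F^n(x)}{n}$, where $F(x)=\lambda\{x\}+b+\lfloor x\rfloor$, $x\in\mathbb{R}$, is the lift of $R_{\lambda,b}$ to the real line, with $F(x+1)=F(x)+1$; the limit exists and does not depend on $x\in\mathbb{R}$. Let $$\mathcal{E}=\{(\lambda,b)\in\mathbb{R}^2 : 0<1-\lambda<b<1 \text{ and } \rho(R_{\lambda,b}) \text{ is irrational}\}.$$ **Corollary.** Let $0<b<1$. Then the set $\{\lambda\in(0,1) : (\lambda,b)\in\mathcal{E}\}$ has Hausdorff dimension zero. -/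

import Mathlib

namespace ContractedRotation

/-- The triangle of parameters `(lam, b)` with `0 < 1 - lam < b < 1`. -/
def triangle : Set (ℝ × ℝ) :=
  {p | 0 < 1 - p.1 ∧ 1 - p.1 < p.2 ∧ p.2 < 1}

theorem lam_pos {lam b : ℝ} (h : (lam, b) ∈ triangle) : 0 < lam := by
  obtain ⟨h1, h2, h3⟩ := h
  dsimp only at h1 h2 h3
  linarith

theorem map_mem {lam b : ℝ} (h : (lam, b) ∈ triangle) (x : Set.Ico (0 : ℝ) 1) :
    (if (x : ℝ) < (1 - b) / lam then lam * x + b else lam * x + b - 1) ∈ Set.Ico (0 : ℝ) 1 := by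
  have hl := lam_pos h
  obtain ⟨h1, h2, h3⟩ := h
  dsimp only at h1 h2 h3
  obtain ⟨x, hx0, hx1⟩ := x
  have hlx := mul_nonneg hl.le hx0
  have hlx' : lam * x < lam := by nlinarith
  dsimp only
  split_ifs with hc
  · rw [lt_div_iff₀ hl] at hc
    constructor <;> nlinarith
  · rw [not_lt, div_le_iff₀ hl] at hc
    constructor <;> nlinarith

/-- The contracted rotation `R` of the interval `[0,1)` with slope `lam` and translation `b`:
with `c = (1 - b) / lam`, it is `x ↦ lam * x + b` on `[0,c)` and `x ↦ lam * x + b - 1`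
on `[c,1)`. -/
noncomputable def map (lam b : ℝ) (h : (lam, b) ∈ triangle) (x : Set.Ico (0 : ℝ) 1) :
    Set.Ico (0 : ℝ) 1 :=
  ⟨if (x : ℝ) < (1 - b) / lam then lam * x + b else lam * x + b - 1, map_mem h x⟩

/-- The lift `F x = lam * {x} + b + ⌊x⌋` of the contracted rotation to the real line, as a
monotone map with `F (x + 1) = F x + 1`. -/
noncomputable def lift (lam b : ℝ) (h : (lam, b) ∈ triangle) : CircleDeg1Lift where
  toFun x := lam * Int.fract x + b + ⌊x⌋
  monotone' := by
    intro x y hxy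
    have hl := lam_pos h
    have h1 : lam < 1 := sub_pos.mp h.1
    have hx := Int.fract_add_floor x
    have hy := Int.fract_add_floor y
    have hf : (⌊x⌋ : ℝ) ≤ ⌊y⌋ := by exact_mod_cast Int.floor_mono hxy
    dsimp only
    nlinarith
  map_add_one' := by
    intro x
    simp only [Int.fract_add_one, Int.floor_add_one]
    push_cast
    ring

/-- The map `lift` is indeed a lift of `map` through `ℝ → ℝ / ℤ = [0,1)`. -/
theorem fract_lift (lam b : ℝ) (h : (lam, b) ∈ triangle) (x : ℝ) :
    Int.fract (lift lam b h x) =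
      map lam b h ⟨Int.fract x, Int.fract_nonneg x, Int.fract_lt_one x⟩ := by
  have hm := (map lam b h ⟨Int.fract x, Int.fract_nonneg x, Int.fract_lt_one x⟩).2
  refine Int.fract_eq_iff.mpr ⟨hm.1, hm.2, ?_⟩
  change ∃ z : ℤ, lam * Int.fract x + b + ⌊x⌋ -
    (if Int.fract x < (1 - b) / lam then lam * Int.fract x + b
      else lam * Int.fract x + b - 1) = z
  split_ifs
  · exact ⟨⌊x⌋, by ring⟩
  · exact ⟨⌊x⌋ + 1, by push_cast; ring⟩

/-- The rotation number of the contracted rotation: the limit of `F^n x / n`, for any real `x`,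
where `F` is the lift above (Mathlib's translation number of `F`). -/
noncomputable def rotationNumber (lam b : ℝ) (h : (lam, b) ∈ triangle) : ℝ :=
  (lift lam b h).translationNumber

/-- The parameters in the triangle whose contracted rotation has irrational rotation number. -/
def exceptionalSet : Set (ℝ × ℝ) :=
  {p | ∃ h : (p.1, p.2) ∈ triangle, Irrational (rotationNumber p.1 p.2 h)}

end ContractedRotation

/-!
Write `F` for the lift of the contracted rotation and `ρ` for its rotation number.

When `ρ` is irrational, the point `0` has an infinite backward orbit `0 = y₀, y₁, y₂, …` under `F`.
Indeed, a point outside the range of `F` lies in a gap `[lam + b + k - 1, b + k)`, and if `F ^ n`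
carried a point of such a gap to `0`, then `ρ` would be the rational number `-k / (n + 1)`.
Moreover `⌊y n⌋ = -⌈n ρ⌉`, so that the integer parts along the orbit depend on `ρ` only.

Inverse branches of `F` are expanding. If `lam ≤ lam'` are two parameters whose backward orbits
`y`, `y'` have the same integer parts up to time `N`, then `e n = y n - y' n` satisfies
`lam' * e (n + 1) = e n + (lam' - lam) * fract (y (n + 1))`, hence grows at least like
`(lam' - lam) * (1 - b) / lam' ^ n`; since `e N < 1`, this gives `lam' - lam ≤ lam' ^ N / (1 - b)`
(`sub_le_of_ceil_eq`).

All the numbers `⌈n ρ⌉`, `n ≤ N`, are monotone in `ρ`, so they are determined by their sum, which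
takes at most `N ^ 2 + N + 1` values. The exceptional parameters `lam ≤ r < 1` are therefore covered
by polynomially many sets of exponentially small diameter, and have Hausdorff dimension zero. It
remains to let `r` increase to `1`.
-/

open Set Filter Topology MeasureTheory
open scoped NNReal ENNReal

/-! ### Circle maps with an invariant half-line -/

namespace CircleDeg1Lift

theorem translationNumber_le_of_forall_lt (f : CircleDeg1Lift) (k m : ℤ)
    (h : ∀ x : ℝ, x < k → f x < k + m) : f.translationNumber ≤ m := by
  -- Normalise to `m = 0`; then `Iio k` is invariant, so no power of `g` moves points far right.
  set g : CircleDeg1Lift := translate (Multiplicative.ofAdd (-(m : ℝ))) * f with hg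
  have hgx : ∀ x, g x = f x - m := fun x => by simp [hg]; ring
  have hgt : g.translationNumber = f.translationNumber - m := by
    have hcomm : Commute (translate (Multiplicative.ofAdd (-(m : ℝ))) : CircleDeg1Lift) f := by
      refine CircleDeg1Lift.ext fun x => ?_
      have := f.map_sub_int x m
      simp only [mul_apply, translate_apply]
      rw [neg_add_eq_sub, neg_add_eq_sub, this]
    rw [hg, translationNumber_mul_of_commute hcomm, translationNumber_translate]
    ring
  have hiter : ∀ n : ℕ, ∀ x : ℝ, x < k → (g ^ n) x < k := by
    intro n
    induction n with
    | zero => intro x hx; simpa using hx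
    | succ n ih =>
      intro x hx
      rw [pow_succ, mul_apply]
      refine ih _ ?_
      rw [hgx]
      linarith [h x hx]
  by_contra! hlt
  have hpos : 0 < g.translationNumber := by linarith
  obtain ⟨n, hn⟩ := exists_nat_gt (1 / g.translationNumber)
  rw [div_lt_iff₀ hpos, ← translationNumber_pow] at hn
  have h1 := lt_map_of_int_lt_translationNumber (g ^ n) (n := 1) (by exact_mod_cast hn)
    ((k : ℝ) - 1)
  have h2 := hiter n ((k : ℝ) - 1) (by linarith)
  push_cast at h1
  linarith

end CircleDeg1Lift

namespace ContractedRotation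

/-! ### The lift and its rotation number -/

variable {lam b : ℝ}

theorem lift_apply (h : (lam, b) ∈ triangle) (x : ℝ) :
    lift lam b h x = lam * Int.fract x + b + ⌊x⌋ := rfl

theorem lam_lt_one (h : (lam, b) ∈ triangle) : lam < 1 := sub_pos.mp h.1

theorem lift_strictMono (h : (lam, b) ∈ triangle) : StrictMono (lift lam b h) := by
  intro x y hxy
  have hl := lam_pos h
  have h1 := lam_lt_one h
  have hx := Int.fract_add_floor x
  have hy := Int.fract_add_floor y
  have hf : (⌊x⌋ : ℝ) ≤ ⌊y⌋ := by exact_mod_cast Int.floor_mono hxy.le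
  rw [lift_apply, lift_apply]
  nlinarith

theorem lift_intCast (h : (lam, b) ∈ triangle) (k : ℤ) : lift lam b h k = b + k := by
  simp [lift_apply]

theorem lift_lt_of_lt_intCast (h : (lam, b) ∈ triangle) {x : ℝ} {k : ℤ} (hx : x < k) :
    lift lam b h x < lam + b + (k - 1) := by
  have hl := lam_pos h
  have h1 := lam_lt_one h
  have hf := Int.fract_lt_one x
  have hk : (⌊x⌋ : ℝ) ≤ k - 1 := by
    exact_mod_cast Int.le_sub_one_of_lt (Int.floor_lt.mpr hx)
  rw [lift_apply]
  nlinarith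

theorem lift_pow_strictMono (h : (lam, b) ∈ triangle) (n : ℕ) : StrictMono (lift lam b h ^ n) := by
  rw [CircleDeg1Lift.coe_pow]
  exact (lift_strictMono h).iterate n

theorem rotationNumber_nonneg (h : (lam, b) ∈ triangle) : 0 ≤ rotationNumber lam b h := by
  have hb : 0 < b := h.1.trans h.2.1
  have h0 := lift_intCast h 0
  have := CircleDeg1Lift.le_translationNumber_of_add_int_le (lift lam b h) (x := 0) (m := 0)
    (by push_cast at h0 ⊢; linarith)
  simpa [rotationNumber] using this

theorem rotationNumber_le_one (h : (lam, b) ∈ triangle) : rotationNumber lam b h ≤ 1 := by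
  have hb : b < 1 := h.2.2
  have h0 := lift_intCast h 0
  have := CircleDeg1Lift.translationNumber_le_of_le_add_int (lift lam b h) (x := 0) (m := 1)
    (by push_cast at h0 ⊢; linarith)
  simpa [rotationNumber] using this

/-- A point whose orbit reaches `0` is not in a gap of the range when the rotation number is
irrational. -/
theorem exists_lift_eq (h : (lam, b) ∈ triangle) (hirr : Irrational (rotationNumber lam b h))
    {n : ℕ} {y : ℝ} (hy : (lift lam b h ^ n) y = 0) : ∃ x, lift lam b h x = y := by
  have hl := lam_pos h
  set k := ⌊y - b⌋ with hk
  have hk0 : (k : ℝ) ≤ y - b := Int.floor_le _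
  have hk1 : y - b < k + 1 := Int.lt_floor_add_one _
  rcases lt_or_ge y (lam + b + k) with hlt | hge
  · have hdiv : lam * ((y - b - k) / lam) = y - b - k := by field_simp
    refine ⟨(y - b - k) / lam + k, ?_⟩
    have hfr : Int.fract ((y - b - k) / lam + k) = (y - b - k) / lam := by
      rw [Int.fract_add_intCast, Int.fract_eq_self]
      exact ⟨div_nonneg (by linarith) hl.le, by rw [div_lt_one hl]; linarith⟩
    have hfl := Int.self_sub_fract ((y - b - k) / lam + k)
    rw [lift_apply, ← hfl, hfr, hdiv]
    ring
  · -- Here `y` lies in the gap below `F (k + 1)`, which forces `(n + 1) ρ = -(k + 1)`.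
    exfalso
    have hup : (lift lam b h ^ (n + 1)).translationNumber ≤ ((-(k + 1) : ℤ) : ℝ) := by
      refine CircleDeg1Lift.translationNumber_le_of_forall_lt _ (k + 1) _ fun x hx => ?_
      have hxy : lift lam b h x < y := by
        have := lift_lt_of_lt_intCast h hx
        push_cast at this
        linarith
      rw [pow_succ, CircleDeg1Lift.mul_apply]
      have := lift_pow_strictMono h n hxy
      push_cast
      linarith
    have hlo : ((-(k + 1) : ℤ) : ℝ) ≤ (lift lam b h ^ (n + 1)).translationNumber := by
      refine CircleDeg1Lift.le_translationNumber_of_add_int_le _ (x := ((k + 1 : ℤ) : ℝ)) ?_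
      rw [pow_succ, CircleDeg1Lift.mul_apply, lift_intCast]
      have := (lift lam b h ^ n).monotone (show y ≤ b + ((k + 1 : ℤ) : ℝ) by push_cast; linarith)
      push_cast at this ⊢
      linarith
    have heq := le_antisymm hup hlo
    rw [CircleDeg1Lift.translationNumber_pow] at heq
    exact (hirr.natCast_mul n.succ_ne_zero).ne_int _ heq

/-! ### Backward orbits of zero -/

theorem exists_backward_orbit (h : (lam, b) ∈ triangle)
    (hirr : Irrational (rotationNumber lam b h)) :
    ∃ y : ℕ → ℝ, y 0 = 0 ∧ (∀ n, lift lam b h (y (n + 1)) = y n) ∧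
      ∀ n, ⌊y n⌋ = -⌈n * rotationNumber lam b h⌉ := by
  have hex : ∀ n : ℕ, ∃ y, (lift lam b h ^ n) y = 0 := by
    intro n
    induction n with
    | zero => exact ⟨0, by simp⟩
    | succ n ih =>
      obtain ⟨y, hy⟩ := ih
      obtain ⟨x, hx⟩ := exists_lift_eq h hirr hy
      exact ⟨x, by rw [pow_succ, CircleDeg1Lift.mul_apply, hx, hy]⟩
  choose y hy using hex
  have hy0 : y 0 = 0 := by simpa using hy 0
  refine ⟨y, hy0, fun n => ?_, fun n => ?_⟩
  · apply (lift_pow_strictMono h n).injective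
    rw [← CircleDeg1Lift.mul_apply, ← pow_succ, hy, hy]
  · rcases Nat.eq_zero_or_pos n with rfl | hn
    · simp [hy0]
    have hτ : (lift lam b h ^ n).translationNumber = n * rotationNumber lam b h :=
      CircleDeg1Lift.translationNumber_pow _ n
    have hmap : ∀ m : ℤ, (lift lam b h ^ n) m = (lift lam b h ^ n) 0 + m := fun m => by
      simpa using (lift lam b h ^ n).map_add_int 0 m
    rw [← Int.floor_neg]
    refine eq_of_forall_le_iff fun m => ?_
    rw [Int.le_floor, Int.le_floor]
    constructor
    · intro hm
      have h1 := (lift lam b h ^ n).monotone hm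
      rw [hmap, hy] at h1
      have h2 := CircleDeg1Lift.translationNumber_le_of_le_add_int (lift lam b h ^ n) (x := 0)
        (m := -m) (by push_cast; linarith)
      rw [hτ] at h2
      push_cast at h2
      linarith
    · intro hm
      by_contra! hlt
      have h1 := (lift lam b h ^ n).monotone hlt.le
      rw [hmap, hy] at h1
      have h2 := CircleDeg1Lift.le_translationNumber_of_add_int_le (lift lam b h ^ n) (x := 0)
        (m := -m) (by push_cast; linarith)
      rw [hτ] at h2
      push_cast at h2
      -- Only irrationality excludes the case `n ρ = -m`.
      refine (hirr.natCast_mul hn.ne').ne_int (-m) ?_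
      push_cast
      linarith

/-- Two parameters whose rotation numbers agree to order `N` are exponentially close, by expansion
of the inverse branches along the backward orbits of `0`. -/
theorem sub_le_of_ceil_eq {lam' : ℝ} (h : (lam, b) ∈ triangle) (h' : (lam', b) ∈ triangle)
    (hirr : Irrational (rotationNumber lam b h)) (hirr' : Irrational (rotationNumber lam' b h'))
    (hle : lam ≤ lam') (N : ℕ)
    (hN : ∀ n ≤ N, ⌈n * rotationNumber lam b h⌉ = ⌈n * rotationNumber lam' b h'⌉) :
    lam' - lam ≤ lam' ^ N / (1 - b) := by
  obtain ⟨y, hy0, hy, hfl⟩ := exists_backward_orbit h hirr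
  obtain ⟨y', hy0', hy', hfl'⟩ := exists_backward_orbit h' hirr'
  have hl := lam_pos h
  have hl' := lam_pos h'
  have hlam1 := lam_lt_one h
  have hlam1' := lam_lt_one h'
  have hb1 : b < 1 := h.2.2
  have hfloor : ∀ n ≤ N, ⌊y n⌋ = ⌊y' n⌋ := fun n hn => by rw [hfl, hfl', hN n hn]
  have hrec : ∀ n, n + 1 ≤ N →
      lam' * (y (n + 1) - y' (n + 1)) = y n - y' n + (lam' - lam) * Int.fract (y (n + 1)) := by
    intro n hn
    have h1 := hy n
    have h2 := hy' n
    rw [lift_apply] at h1 h2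
    have h3 : (⌊y (n + 1)⌋ : ℝ) = ⌊y' (n + 1)⌋ := by rw [hfloor _ hn]
    have h4 := Int.fract_add_floor (y (n + 1))
    have h5 := Int.fract_add_floor (y' (n + 1))
    linear_combination h1 - h2 - (1 - lam') * h3 - lam' * h4 + lam' * h5
  rcases Nat.eq_zero_or_pos N with rfl | hpos
  · rw [pow_zero, le_div_iff₀ (by linarith)]
    nlinarith [h.1.trans h.2.1]
  -- The first preimage of `0` is `c - 1`, with fractional part `c = (1 - b) / lam ≥ 1 - b`.
  have hfract : 1 - b ≤ Int.fract (y 1) := by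
    have h1 := hy 0
    rw [hy0, lift_apply] at h1
    have h2 := Int.fract_nonneg (y 1)
    have h3 := Int.fract_lt_one (y 1)
    have hb0 : 0 < b := h.1.trans h.2.1
    have h4 : (⌊y (0 + 1)⌋ : ℝ) ≤ -1 := by
      have : ⌊y (0 + 1)⌋ < 0 := by
        have : (⌊y (0 + 1)⌋ : ℝ) < 0 := by nlinarith
        exact_mod_cast this
      exact_mod_cast Int.le_sub_one_of_lt this
    simp only [zero_add] at h1 h4
    nlinarith
  have hgrow : ∀ n, n + 1 ≤ N →
      (lam' - lam) * (1 - b) ≤ lam' ^ (n + 1) * (y (n + 1) - y' (n + 1)) := by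
    intro n
    induction n with
    | zero =>
      intro hn
      have h1 := hrec 0 hn
      rw [hy0, hy0'] at h1
      simp only [zero_add, pow_one] at h1 ⊢
      rw [h1]
      nlinarith
    | succ n ih =>
      intro hn
      have h1 := hrec (n + 1) hn
      have h2 : 0 ≤ (lam' - lam) * Int.fract (y (n + 1 + 1)) :=
        mul_nonneg (by linarith) (Int.fract_nonneg _)
      calc (lam' - lam) * (1 - b) ≤ lam' ^ (n + 1) * (y (n + 1) - y' (n + 1)) := ih (by omega)
        _ ≤ lam' ^ (n + 1) * (lam' * (y (n + 1 + 1) - y' (n + 1 + 1))) := by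
          gcongr
          linarith
        _ = lam' ^ (n + 1 + 1) * (y (n + 1 + 1) - y' (n + 1 + 1)) := by ring
  obtain ⟨n, rfl⟩ : ∃ n, N = n + 1 := ⟨N - 1, by omega⟩
  have hlt : y (n + 1) - y' (n + 1) < 1 :=
    (abs_lt.mp (Int.abs_sub_lt_one_of_floor_eq_floor (hfloor _ le_rfl))).2
  rw [le_div_iff₀ (by linarith)]
  nlinarith [hgrow n le_rfl, pow_pos hl' (n + 1)]

/-! ### Counting combinatorial types and covering -/

/-- The numbers `⌈n ρ⌉`, `n ≤ N`, encoded by their sum. By monotonicity in `ρ`, the sum determines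
them (`ceil_eq_of_ceilSum_eq`). -/
noncomputable def ceilSum (N : ℕ) (ρ : ℝ) : ℕ :=
  ∑ n ∈ Finset.range (N + 1), ⌈n * ρ⌉₊

theorem ceilSum_lt (N : ℕ) {ρ : ℝ} (h1 : ρ ≤ 1) : ceilSum N ρ < N ^ 2 + N + 1 := by
  have : ceilSum N ρ ≤ ∑ n ∈ Finset.range (N + 1), N := by
    refine Finset.sum_le_sum fun n hn => Nat.ceil_le.mpr ?_
    have hn : (n : ℝ) ≤ N := by exact_mod_cast Nat.lt_succ_iff.mp (Finset.mem_range.mp hn)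
    nlinarith [(Nat.cast_nonneg n : (0 : ℝ) ≤ n)]
  rw [Finset.sum_const, Finset.card_range, smul_eq_mul] at this
  nlinarith

theorem ceil_eq_of_ceilSum_eq {N : ℕ} {ρ ρ' : ℝ} (h0 : 0 ≤ ρ) (h0' : 0 ≤ ρ')
    (h : ceilSum N ρ = ceilSum N ρ') {n : ℕ} (hn : n ≤ N) :
    ⌈n * ρ⌉ = ⌈n * ρ'⌉ := by
  wlog hle : ρ ≤ ρ' generalizing ρ ρ'
  · exact (this h0' h0 h.symm (le_of_not_ge hle)).symm
  have hmono : ∀ i ∈ Finset.range (N + 1), ⌈i * ρ⌉₊ ≤ ⌈i * ρ'⌉₊ := fun i _ =>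
    Nat.ceil_mono (by gcongr)
  have := (Finset.sum_eq_sum_iff_of_le hmono).mp h n (Finset.mem_range.mpr (by omega))
  rw [← Int.natCast_ceil_eq_ceil (by positivity), ← Int.natCast_ceil_eq_ceil (by positivity), this]

theorem dimH_exceptional_le_eq_zero (hb1 : b < 1) {r : ℝ} (hr0 : 0 < r) (hr1 : r < 1) :
    dimH {lam : ℝ | lam ≤ r ∧ (lam, b) ∈ exceptionalSet} = 0 := by
  set S := {lam : ℝ | lam ≤ r ∧ (lam, b) ∈ exceptionalSet} with hS
  let t : ∀ N : ℕ, Fin (N ^ 2 + N + 1) → Set ℝ := fun N i =>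
    {lam | lam ≤ r ∧ ∃ h : (lam, b) ∈ triangle, Irrational (rotationNumber lam b h) ∧
      ceilSum N (rotationNumber lam b h) = i}
  have hcover : ∀ N, S ⊆ ⋃ i, t N i := by
    rintro N lam ⟨hlr, h, hirr⟩
    exact mem_iUnion.mpr
      ⟨⟨_, ceilSum_lt N (rotationNumber_le_one h)⟩, hlr, h, hirr, rfl⟩
  have hdiam : ∀ N i, Metric.ediam (t N i) ≤ ENNReal.ofReal (r ^ N / (1 - b)) := by
    intro N i
    have key : ∀ x ∈ t N i, ∀ y ∈ t N i, x ≤ y → y - x ≤ r ^ N / (1 - b) := by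
      rintro x ⟨-, hx, hxirr, hxi⟩ y ⟨hyr, hy, hyirr, hyi⟩ hxy
      refine (sub_le_of_ceil_eq hx hy hxirr hyirr hxy N fun n hn =>
        ceil_eq_of_ceilSum_eq (rotationNumber_nonneg hx) (rotationNumber_nonneg hy)
          (hxi.trans hyi.symm) hn).trans ?_
      have := (lam_pos hy).le
      have : 0 ≤ 1 - b := by linarith
      gcongr
    refine Metric.ediam_le_of_forall_dist_le fun x hx y hy => ?_
    rcases le_total x y with hxy | hxy
    · rw [dist_comm, Real.dist_eq, abs_of_nonneg (by linarith)]
      exact key x hx y hy hxy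
    · rw [Real.dist_eq, abs_of_nonneg (by linarith)]
      exact key y hy x hx hxy
  have hr : Tendsto (fun N : ℕ => ENNReal.ofReal (r ^ N / (1 - b))) atTop (𝓝 0) := by
    have := (tendsto_pow_atTop_nhds_zero_of_lt_one hr0.le hr1).div_const (1 - b)
    simpa using ENNReal.tendsto_ofReal this
  have hs : ∀ s : ℝ≥0, 0 < s → dimH S ≤ s := by
    intro s hs0
    have hs0' : (0 : ℝ) < s := by exact_mod_cast hs0
    have hlim := Measure.hausdorffMeasure_le_liminf_sum (s : ℝ) S _ hr t
      (Eventually.of_forall hdiam) (Eventually.of_forall hcover)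
    have hsum : ∀ N : ℕ, ∑ i, Metric.ediam (t N i) ^ (s : ℝ) ≤
        ENNReal.ofReal (((N : ℝ) ^ 2 + N + 1) * ((r ^ N / (1 - b)) ^ (s : ℝ))) := by
      intro N
      have hpos : 0 < 1 - b := by linarith
      calc ∑ i, Metric.ediam (t N i) ^ (s : ℝ)
          ≤ ∑ _i : Fin (N ^ 2 + N + 1), ENNReal.ofReal (r ^ N / (1 - b)) ^ (s : ℝ) :=
            Finset.sum_le_sum fun i _ => ENNReal.rpow_le_rpow (hdiam N i) hs0'.le
        _ = _ := by
          rw [Finset.sum_const, Finset.card_univ, Fintype.card_fin, nsmul_eq_mul,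
            ENNReal.ofReal_rpow_of_nonneg (by positivity) hs0'.le,
            ENNReal.ofReal_mul (by positivity), ← ENNReal.ofReal_natCast]
          push_cast
          rfl
    have hzero : Tendsto (fun N : ℕ => ENNReal.ofReal
        (((N : ℝ) ^ 2 + N + 1) * ((r ^ N / (1 - b)) ^ (s : ℝ)))) atTop (𝓝 0) := by
      have hpos : 0 < 1 - b := by linarith
      have hq0 : 0 ≤ r ^ (s : ℝ) := by positivity
      have hq1 : r ^ (s : ℝ) < 1 := Real.rpow_lt_one hr0.le hr1 hs0'
      have h2 := tendsto_pow_const_mul_const_pow_of_lt_one 2 hq0 hq1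
      have h1 := tendsto_pow_const_mul_const_pow_of_lt_one 1 hq0 hq1
      have h0 := tendsto_pow_const_mul_const_pow_of_lt_one 0 hq0 hq1
      have h3 := ENNReal.tendsto_ofReal (((h2.add h1).add h0).div_const ((1 - b) ^ (s : ℝ)))
      simp only [add_zero, zero_div, ENNReal.ofReal_zero] at h3
      refine h3.congr fun N => ?_
      rw [Real.div_rpow (by positivity) hpos.le, ← Real.rpow_natCast r N, ← Real.rpow_mul hr0.le,
        mul_comm (N : ℝ), Real.rpow_mul hr0.le, Real.rpow_natCast]
      congr 1
      ring
    have hle := hlim.trans (liminf_le_liminf (Eventually.of_forall hsum))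
    rw [hzero.liminf_eq] at hle
    exact dimH_le_of_hausdorffMeasure_ne_top (ne_top_of_le_ne_top ENNReal.zero_ne_top hle)
  refine le_antisymm (le_of_forall_gt fun d hd => ?_) zero_le
  obtain ⟨s, hs0, hsd⟩ := ENNReal.lt_iff_exists_nnreal_btwn.mp hd
  exact (hs s (by exact_mod_cast hs0)).trans_lt hsd

end ContractedRotation

theorem mainTheorem6 (b : ℝ) (hb0 : 0 < b) (hb1 : b < 1) :
    dimH {lam : ℝ | lam ∈ Set.Ioo (0 : ℝ) 1 ∧ (lam, b) ∈ ContractedRotation.exceptionalSet} = 0 := by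
  have hsub : {lam : ℝ | lam ∈ Set.Ioo (0 : ℝ) 1 ∧ (lam, b) ∈ ContractedRotation.exceptionalSet} ⊆
      ⋃ n : ℕ, {lam : ℝ | lam ≤ 1 - 1 / ((n : ℝ) + 2) ∧
        (lam, b) ∈ ContractedRotation.exceptionalSet} := by
    rintro lam ⟨hlam, hE⟩
    obtain ⟨n, hn⟩ := exists_nat_one_div_lt (sub_pos.mpr hlam.2)
    refine mem_iUnion.mpr ⟨n, ?_, hE⟩
    have : 1 / ((n : ℝ) + 2) ≤ 1 / ((n : ℝ) + 1) := by gcongr; norm_num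
    linarith
  refine le_antisymm ((dimH_mono hsub).trans ?_) zero_le
  rw [dimH_iUnion]
  refine iSup_le fun n => (ContractedRotation.dimH_exceptional_le_eq_zero hb1 ?_ ?_).le
  · have : 1 / ((n : ℝ) + 2) < 1 := by
      rw [div_lt_one (by positivity)]
      linarith [(Nat.cast_nonneg n : (0 : ℝ) ≤ n)]
    linarith
  · have : 0 < 1 / ((n : ℝ) + 2) := by positivity
    linarith
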